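/- Let $n\ge 2$. Consider $n$ columns numbered $1,\dots,n$, with one dot of the Dynkin diagram of type $A_{n-1}$ between each two neighbouring columns. A \emph{loop} $L$ is given by a left end $\ell$ and a right end $r$ with $1\le \ell<r\le n$; it contains the dots between columns $\ell$ and $r$ and passes through the columns $\ell,\ell+1,\dots,r$. A \emph{Kostant picture} $\mathbf p$ in type $A_{n-1}$ is a finite collection of loops, repetitions allowed. A loop $L'$ \emph{encircles} $L$ if the dots contained in $L$ form a proper subset of the dots contained in $L'$; loops containing exactly the same dots are drawn nested, so that of any two of them one encircles the other. For a column $i$, the \emph{collapse} $\hat{\mathbf p}_i$ of $\mathbf p$ along $i$ is the Kostant picture in type $A_{n-2}$ (with $n-1$ columns) defined as follows. Let $\mathbf q$ consist of all loops of $\mathbf p$ that pass through column $i$. Divide $\mathbf q$ into levels: level $m$ consists of the loops of $\mathbf q$ that do not lie in levels $1,\dots,m-1$ and that encircle no loops of $\mathbf q$ except those in levels $1,\dots,m-1$. The loops of one level do not encircle each other, so they are ordered from left to right, say $L_1,\dots,L_k$; replace them by the $k-1$ loops $M_1,\dots,M_{k-1}$, where $M_j$ has the left end of $L_j$ and the right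 end of $L_{j+1}$. Doing this on every level and keeping all loops of $\mathbf p$ that are not in $\mathbf q$, one obtains a picture in which no loop has an end at column $i$; cross out column $i$, identify the two dots on either side of it if both exist (if $i$ is the first or the last column, drop the one dot next to it), and renumber the remaining columns in order. For distinct columns $i_1,i_2\in\{1,\dots,n\}$ let $\hat{\mathbf p}_{(i_1,i_2)}$ denote the picture obtained by first collapsing $\mathbf p$ along column $i_1$ and then collapsing the result along the column that was originally numbered $i_2$ (it now has number $i_2$ if $i_2<i_1$, and $i_2-1$ if $i_2>i_1$). \textbf{Theorem.} For any Kostant picture $\mathbf p$ in type $A_{n-1}$ and any two distinct columns $i_1,i_2$, $$\hat{\mathbf p}_{(i_1,i_2)}=\hat{\mathbf p}_{(i_2,i_1)}.$$ -/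

import Mathlib

namespace Kostant

/-- A loop in the Dynkin diagram of type `A_{n-1}`, in terms of the `n` columns, numbered by
`Fin n` in order, with one dot between each two neighbouring columns. The loop with left end at
column `ℓ` and right end at column `r` contains exactly the dots that lie between columns `ℓ` and
`r`, at least one. -/
@[ext] structure Loop (n : ℕ) where
  left : Fin n
  right : Fin n
  lt : left < right
deriving DecidableEq

/-- A Kostant picture in type `A_{n-1}` : a finite collection of loops, with multiplicities. -/
abbrev Picture (n : ℕ) : Type := Multiset (Loop n)

variable {n : ℕ}

/-- The loop `L` passes through column `i`. -/
def Loop.PassesThrough (L : Loop n) (i : Fin n) : Prop := L.left ≤ i ∧ i ≤ L.right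

instance (L : Loop n) (i : Fin n) : Decidable (L.PassesThrough i) :=
  inferInstanceAs (Decidable (_ ∧ _))

/-- All dots contained in `L` are contained in `L'`. -/
def Loop.Within (L L' : Loop n) : Prop := L'.left ≤ L.left ∧ L.right ≤ L'.right

instance (L L' : Loop n) : Decidable (L.Within L') :=
  inferInstanceAs (Decidable (_ ∧ _))

/-- `Encircled x y` : the drawn loop `x` is encircled by the drawn loop `y`. The individual drawn
loops of a picture `p` are the elements of `p.toEnumFinset`, that is, the pairs `(L, k)` with
`k < p.count L`. Loops that contain the same dots are drawn inside one another, in the order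
of their labels `k`. -/
def Encircled (x y : Loop n × ℕ) : Prop :=
  (x.1 ≠ y.1 ∧ x.1.Within y.1) ∨ (x.1 = y.1 ∧ x.2 < y.2)

instance (x y : Loop n × ℕ) : Decidable (Encircled x y) :=
  inferInstanceAs (Decidable (_ ∨ _))

/-- The loops in `S` that do not encircle any loop in `S`. -/
def innermost (S : Finset (Loop n × ℕ)) : Finset (Loop n × ℕ) :=
  S.filter fun x => ∀ y ∈ S, ¬ Encircled y x

/-- The drawn loops of `q` that are not in the first `k` levels of encirclement. -/
def remaining (q : Picture n) : ℕ → Finset (Loop n × ℕ)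
  | 0 => q.toEnumFinset
  | k + 1 => remaining q k \ innermost (remaining q k)

/-- The levels of encirclement of `q`, counted from `0` : the loops of `q` that are not in earlier
levels and that encircle only loops of earlier levels. -/
def level (q : Picture n) (k : ℕ) : Finset (Loop n × ℕ) := innermost (remaining q k)

/-- `L` lies to the left of `L'`. -/
def Loop.LeftOf (L L' : Loop n) : Prop := L.left < L'.left ∧ L.right < L'.right

instance (L L' : Loop n) : Decidable (L.LeftOf L') :=
  inferInstanceAs (Decidable (_ ∧ _))

/-- The join of two loops. If `L` lies to the left of `L'`, it has the left end of `L` and the right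
end of `L'`. -/
def Loop.join (L L' : Loop n) : Loop n where
  left := min L.left L'.left
  right := max L.right L'.right
  lt := (min_le_left _ _).trans_lt (L.lt.trans_le (le_max_left _ _))

theorem Loop.join_left {L L' : Loop n} (h : L.LeftOf L') : (L.join L').left = L.left :=
  min_eq_left h.1.le

theorem Loop.join_right {L L' : Loop n} (h : L.LeftOf L') : (L.join L').right = L'.right :=
  max_eq_right h.2.le

/-- The pairs of neighbours in `S`, ordered from left to right. -/
def neighbours (S : Finset (Loop n × ℕ)) : Finset ((Loop n × ℕ) × (Loop n × ℕ)) :=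
  (S ×ˢ S).filter fun c =>
    c.1.1.LeftOf c.2.1 ∧ ∀ z ∈ S, ¬ (c.1.1.LeftOf z.1 ∧ z.1.LeftOf c.2.1)

/-- The joins of neighbouring loops: from loops `L₁, …, L_k` that are ordered from left to right,
the loops `M₁, …, M_{k-1}` where `M_j` is the join of `L_j` and `L_{j+1}`. -/
def joins (S : Finset (Loop n × ℕ)) : Picture n :=
  (neighbours S).val.map fun c => c.1.1.join c.2.1

/-- The loops of `p` that pass through column `i`. -/
def through (p : Picture n) (i : Fin n) : Picture n := p.filter fun L => L.PassesThrough i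

/-- All the new loops, formed on all levels of `q`. A picture `q` has at most `q.card` nonempty
levels. -/
def newLoops (q : Picture n) : Picture n := ∑ k ∈ Finset.range q.card, joins (level q k)

/-- The picture obtained from `p` by replacing the loops that pass through column `i` by the new
loops formed from them; column `i` has not yet been crossed out. -/
def replaced (p : Picture n) (i : Fin n) : Picture n :=
  (p.filter fun L => ¬ L.PassesThrough i) + newLoops (through p i)

theorem remaining_subset (q : Picture n) (k : ℕ) : remaining q k ⊆ q.toEnumFinset := by
  induction k with
  | zero => exact Finset.Subset.refl _
  | succ k ih => exact Finset.sdiff_subset.trans ih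

theorem passesThrough_of_mem_level {p : Picture n} {i : Fin n} {k : ℕ} {x : Loop n × ℕ}
    (hx : x ∈ level (through p i) k) : x.1.PassesThrough i := by
  have h := Multiset.mem_of_mem_toEnumFinset
    (remaining_subset _ k (Finset.mem_of_mem_filter x hx))
  exact (Multiset.mem_filter.1 h).2

/-- No loop has an end at column `i` after the replacement. -/
theorem ends_ne_of_mem_replaced {p : Picture n} {i : Fin n} {L : Loop n}
    (hL : L ∈ replaced p i) : L.left ≠ i ∧ L.right ≠ i := by
  rcases Multiset.mem_add.1 hL with h | h
  · have h' := (Multiset.mem_filter.1 h).2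
    refine ⟨fun e => h' ⟨e.le, e ▸ L.lt.le⟩, fun e => h' ⟨e ▸ L.lt.le, e.ge⟩⟩
  · obtain ⟨k, -, hk⟩ := Multiset.mem_sum.1 h
    obtain ⟨c, hc, rfl⟩ := Multiset.mem_map.1 hk
    obtain ⟨hcS, hlt, -⟩ := Finset.mem_filter.1 hc
    obtain ⟨h1, h2⟩ := Finset.mem_product.1 hcS
    have p1 := passesThrough_of_mem_level h1
    have p2 := passesThrough_of_mem_level h2
    rw [Loop.join_left hlt, Loop.join_right hlt]
    exact ⟨(hlt.1.trans_le p2.1).ne, (p1.2.trans_lt hlt.2).ne'⟩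

/-- The new number of column `j` after column `i` has been crossed out: the unique
order-preserving renumbering of the remaining columns. -/
def renumber (i j : Fin (n + 1)) (h : j ≠ i) : Fin n := (finSuccAboveOrderIso i).symm ⟨j, h⟩

/-- The loop `L`, viewed in one rank lower after column `i` has been crossed out and the two dots
on either side of it have been identified. -/
def Loop.crossOut (i : Fin (n + 1)) (L : Loop (n + 1)) (h : L.left ≠ i ∧ L.right ≠ i) :
    Loop n where
  left := renumber i L.left h.1
  right := renumber i L.right h.2
  lt := (finSuccAboveOrderIso i).symm.lt_iff_lt.2 L.lt

/-- The collapse of a Kostant picture along column `i`. -/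
def collapse (p : Picture (n + 1)) (i : Fin (n + 1)) : Picture n :=
  (replaced p i).pmap (Loop.crossOut i) fun _ hL => ends_ne_of_mem_replaced hL

/-- The result of collapsing along column `i₁` and then along the column that was numbered `i₂`
in the original picture. -/
def collapsePair (p : Picture (n + 2)) (i₁ i₂ : Fin (n + 2)) (h : i₁ ≠ i₂) : Picture n :=
  collapse (collapse p i₁) (renumber i₁ i₂ h.symm)

end Kostant

namespace Kostant

/-! Encode a picture by the multiplicities `a ℓ r` of its loops. Among the loops through column `i`,
the level of a loop is the length of the longest chain of loops nested inside it, so the number of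
levels meeting the box `[ℓ, r]` is a last passage time G(ℓ, r) of `a`. A level with k ≥ 1 loops in
the box yields exactly k - 1 new loops there. The box counts thus drop by G, and mixed second
differences turn this into the local formula `transfer` for the new multiplicities
(`mult_replaced`).

It remains to commute two transfers of arrays (`transfer_comm`). For i < j let α, γ be the passage
times of `a` for i, j, and let β, δ be those for j, i after the other transfer. Induction on the box
proves α + β = γ + δ together with two auxiliary relations (`passage_relations`); comparing this
identity at the four corners of a unit square gives the commutation.

Crossing out columns is undone by order embeddings, with which the replacement commutes
(`replaced_map`). The embedding that skips both columns does not depend on their order, and it acts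
injectively on pictures. -/

/-! ### Last passage times and transfers -/

/-- The last passage time from `(i, i)` to `(ℓ, r)` in the environment `a`, where a path moves left
in the first coordinate and right in the second. -/
def passage (i : ℤ) (a : ℤ → ℤ → ℕ) (ℓ r : ℤ) : ℕ :=
  if ℓ ≤ i ∧ i ≤ r then max (passage i a (ℓ + 1) r) (passage i a ℓ (r - 1)) + a ℓ r else 0
termination_by (r - ℓ + 1).toNat

/-- The effect of replacing the loops through column `i`, in terms of multiplicities. -/
def transfer (i : ℤ) (a : ℤ → ℤ → ℕ) (ℓ r : ℤ) : ℕ :=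
  if ℓ ≤ i ∧ i ≤ r then
    min (passage i a (ℓ + 1) r) (passage i a ℓ (r - 1)) - passage i a (ℓ + 1) (r - 1)
  else a ℓ r

theorem passage_of_mem {i ℓ r : ℤ} (a : ℤ → ℤ → ℕ) (h1 : ℓ ≤ i) (h2 : i ≤ r) :
    passage i a ℓ r = max (passage i a (ℓ + 1) r) (passage i a ℓ (r - 1)) + a ℓ r := by
  rw [passage, if_pos ⟨h1, h2⟩]

theorem passage_of_lt_left {i ℓ : ℤ} (a : ℤ → ℤ → ℕ) (r : ℤ) (h : i < ℓ) :
    passage i a ℓ r = 0 := by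
  rw [passage, if_neg (by omega)]

theorem passage_of_right_lt {i r : ℤ} (a : ℤ → ℤ → ℕ) (ℓ : ℤ) (h : r < i) :
    passage i a ℓ r = 0 := by
  rw [passage, if_neg (by omega)]

theorem transfer_of_mem {i ℓ r : ℤ} (a : ℤ → ℤ → ℕ) (h1 : ℓ ≤ i) (h2 : i ≤ r) :
    transfer i a ℓ r =
      min (passage i a (ℓ + 1) r) (passage i a ℓ (r - 1)) - passage i a (ℓ + 1) (r - 1) :=
  if_pos ⟨h1, h2⟩

theorem transfer_of_lt_left {i ℓ : ℤ} (a : ℤ → ℤ → ℕ) (r : ℤ) (h : i < ℓ) :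
    transfer i a ℓ r = a ℓ r := if_neg (by omega)

theorem transfer_of_right_lt {i r : ℤ} (a : ℤ → ℤ → ℕ) (ℓ : ℤ) (h : r < i) :
    transfer i a ℓ r = a ℓ r := if_neg (by omega)

theorem passage_succ_left_le (i : ℤ) (a : ℤ → ℤ → ℕ) (ℓ r : ℤ) :
    passage i a (ℓ + 1) r ≤ passage i a ℓ r := by
  by_cases h : ℓ ≤ i ∧ i ≤ r
  · rw [passage_of_mem a h.1 h.2]; omega
  · rw [passage, if_neg (by omega)]; omega

theorem passage_pred_right_le (i : ℤ) (a : ℤ → ℤ → ℕ) (ℓ r : ℤ) :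
    passage i a ℓ (r - 1) ≤ passage i a ℓ r := by
  by_cases h : ℓ ≤ i ∧ i ≤ r
  · rw [passage_of_mem a h.1 h.2]; omega
  · rw [passage, if_neg (by omega)]; omega

theorem passage_antitone_left (i : ℤ) (a : ℤ → ℤ → ℕ) (r : ℤ) :
    Antitone fun ℓ => passage i a ℓ r :=
  antitone_int_of_succ_le fun ℓ => passage_succ_left_le i a ℓ r

theorem passage_monotone_right (i : ℤ) (a : ℤ → ℤ → ℕ) (ℓ : ℤ) :
    Monotone fun r => passage i a ℓ r :=
  monotone_int_of_le_succ fun r => by simpa using passage_pred_right_le i a ℓ (r + 1)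

theorem passage_congr {i : ℤ} {a b : ℤ → ℤ → ℕ} {ℓ r : ℤ}
    (h : ∀ ℓ' r', ℓ ≤ ℓ' → ℓ' ≤ i → i ≤ r' → r' ≤ r → a ℓ' r' = b ℓ' r') :
    passage i a ℓ r = passage i b ℓ r := by
  rw [passage, passage.eq_1 i b]
  split_ifs with hi
  · rw [passage_congr (ℓ := ℓ + 1) fun ℓ' r' h1 h2 h3 h4 => h ℓ' r' (by omega) h2 h3 h4,
      passage_congr (r := r - 1) fun ℓ' r' h1 h2 h3 h4 => h ℓ' r' h1 h2 h3 (by omega),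
      h ℓ r le_rfl hi.1 hi.2 le_rfl]
  · rfl
termination_by (r - ℓ + 1).toNat

theorem passage_transfer_of_lt_left {i j ℓ : ℤ} (a : ℤ → ℤ → ℕ) (r : ℤ) (h : i < ℓ) :
    passage j (transfer i a) ℓ r = passage j a ℓ r :=
  passage_congr fun ℓ' r' h1 _ _ _ => transfer_of_lt_left a r' (by omega)

theorem passage_transfer_of_right_lt {i j r : ℤ} (a : ℤ → ℤ → ℕ) (ℓ : ℤ) (h : r < j) :
    passage i (transfer j a) ℓ r = passage i a ℓ r :=
  passage_congr fun ℓ' r' _ _ _ h2 => transfer_of_right_lt a ℓ' (by omega)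

/-! ### Commutation of transfers -/

section LocalRule

variable {αu αl αd βu βl βd γu γl γd δu δl δd : ℕ}

/-- The suffixes u, l, d mark the corners (ℓ+1, r), (ℓ, r-1), (ℓ+1, r-1). This is the inductive step
for the second of the `passage_relations`, with the summand `a ℓ r` common to α and γ cancelled and
β expanded by its recursion. -/
theorem local_horizontal (hαu : αd ≤ αu) (hαl : αd ≤ αl)
    (hhor : γu + αd = αu + max γd βu)
    (hver : αl + γd = γl + max αd δl) (hsl : αl + βl = γl + δl) :
    max γu γl + αl =
      max αu αl + max γl (max βu βl + (min αu αl - αd)) := by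
  omega

theorem local_sum (hαu : αd ≤ αu) (hαl : αd ≤ αl)
    (hγu : γd ≤ γu) (hγl : γd ≤ γl)
    (hhor : γu + αd = αu + max γd βu) (hver : αl + γd = γl + max αd δl)
    (hsd : αd + βd = γd + δd) (hsl : αl + βl = γl + δl) (hsu : αu + βu = γu + δu) :
    max αu αl + (max βu βl + (min αu αl - αd)) =
      max γu γl + (max δu δl + (min γu γl - γd)) := by
  omega

end LocalRule

/-- The relations between the passage times of the two ways of applying the transfers along `i` and
`j`, for `i < j`. -/
theorem passage_relations {i j : ℤ} (hij : i < j) (a : ℤ → ℤ → ℕ) {ℓ r : ℤ}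
    (hℓ : ℓ ≤ i + 1) (hr : j - 1 ≤ r) :
    passage i a ℓ r + passage j (transfer i a) ℓ r =
        passage j a ℓ r + passage i (transfer j a) ℓ r ∧
      (j ≤ r → passage j a ℓ r + passage i a ℓ (r - 1) =
        passage i a ℓ r + max (passage j a ℓ (r - 1)) (passage j (transfer i a) ℓ r)) ∧
      (ℓ ≤ i → passage i a ℓ r + passage j a (ℓ + 1) r =
        passage j a ℓ r + max (passage i a (ℓ + 1) r) (passage i (transfer j a) ℓ r)) := by
  -- On the edge ℓ = i + 1 both passage times for `i` vanish, and the transfer along `i` is not seen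
  -- by `j`, so β = γ. The edge r = j - 1 is the mirror image.
  rcases hℓ.eq_or_lt with rfl | hℓ'
  · have h1 := passage_of_lt_left a r (lt_add_one i)
    have h2 := passage_of_lt_left a (r - 1) (lt_add_one i)
    have h3 := passage_of_lt_left (transfer j a) r (lt_add_one i)
    have h4 := passage_transfer_of_lt_left (j := j) a r (lt_add_one i)
    have h5 := passage_pred_right_le j a (i + 1) r
    refine ⟨by omega, fun _ => by omega, fun h => by omega⟩
  rcases hr.eq_or_lt with rfl | hr'
  · have h1 := passage_of_right_lt a ℓ (sub_one_lt j)
    have h2 := passage_of_right_lt a (ℓ + 1) (sub_one_lt j)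
    have h3 := passage_of_right_lt (transfer i a) ℓ (sub_one_lt j)
    have h4 := passage_transfer_of_right_lt (i := i) a ℓ (sub_one_lt j)
    have h5 := passage_succ_left_le i a ℓ (j - 1)
    refine ⟨by omega, fun h => by omega, fun _ => by omega⟩
  have hℓi : ℓ ≤ i := by omega
  have hjr : j ≤ r := by omega
  obtain ⟨su, hu, -⟩ := passage_relations hij a (ℓ := ℓ + 1) (r := r) (by omega) hr
  obtain ⟨sl, -, hl⟩ := passage_relations hij a (ℓ := ℓ) (r := r - 1) hℓ (by omega)
  obtain ⟨sd, -, -⟩ := passage_relations hij a (ℓ := ℓ + 1) (r := r - 1) (by omega) (by omega)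
  have hu := hu hjr
  have hl := hl hℓi
  have e1 := passage_of_mem a hℓi (hij.le.trans hjr)
  have e2 := passage_of_mem a (hℓi.trans hij.le) hjr
  have e3 := passage_of_mem (transfer i a) (hℓi.trans hij.le) hjr
  have e4 := passage_of_mem (transfer j a) hℓi (hij.le.trans hjr)
  rw [transfer_of_mem a hℓi (hij.le.trans hjr)] at e3
  rw [transfer_of_mem a (hℓi.trans hij.le) hjr] at e4
  have mαu := passage_pred_right_le i a (ℓ + 1) r
  have mαl := passage_succ_left_le i a ℓ (r - 1)
  have mγu := passage_pred_right_le j a (ℓ + 1) r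
  have mγl := passage_succ_left_le j a ℓ (r - 1)
  have H := local_horizontal mαu mαl hu hl sl
  -- The third relation is the second one reflected: exchange α with γ, β with δ and u with l.
  have V := local_horizontal mγl mγu hl hu su.symm
  have S := local_sum mαu mαl mγu mγl hu hl sd sl su
  rw [max_comm (passage i a ℓ _), max_comm (passage j a ℓ _), max_comm (passage i (transfer j a) ℓ _),
    min_comm (passage j a ℓ _)] at V
  rw [← e3] at H S
  rw [← e4] at V S
  refine ⟨?_, fun _ => ?_, fun _ => ?_⟩
  · rw [e1, e2, Nat.add_right_comm, S, Nat.add_right_comm]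
  · rw [e1, e2, Nat.add_right_comm, H, Nat.add_right_comm]
  · rw [e1, e2, Nat.add_right_comm, V, Nat.add_right_comm]
termination_by (r - ℓ + 1).toNat

theorem transfer_comm_of_lt {i j : ℤ} (hij : i < j) (a : ℤ → ℤ → ℕ) :
    transfer j (transfer i a) = transfer i (transfer j a) := by
  funext ℓ r
  rcases lt_or_ge i ℓ with hℓ | hℓ
  · rw [transfer_of_lt_left _ r hℓ]
    unfold transfer
    split_ifs <;> first | omega | rfl | skip
    rw [← passage_transfer_of_lt_left a r (show i < ℓ + 1 by omega),
      ← passage_transfer_of_lt_left a (r - 1) (show i < ℓ + 1 by omega),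
      ← passage_transfer_of_lt_left a (r - 1) hℓ]
    rfl
  rcases lt_or_ge r j with hr | hr
  · rw [transfer_of_right_lt _ ℓ hr]
    unfold transfer
    split_ifs <;> first | omega | rfl | skip
    rw [← passage_transfer_of_right_lt a (ℓ + 1) hr,
      ← passage_transfer_of_right_lt a ℓ (show r - 1 < j by omega),
      ← passage_transfer_of_right_lt a (ℓ + 1) (show r - 1 < j by omega)]
    rfl
  obtain ⟨s, -, -⟩ := passage_relations hij a (ℓ := ℓ) (r := r) (by omega) (by omega)
  obtain ⟨su, -, -⟩ := passage_relations hij a (ℓ := ℓ + 1) (r := r) (by omega) (by omega)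
  obtain ⟨sl, -, -⟩ := passage_relations hij a (ℓ := ℓ) (r := r - 1) (by omega) (by omega)
  obtain ⟨sd, -, -⟩ := passage_relations hij a (ℓ := ℓ + 1) (r := r - 1) (by omega) (by omega)
  have e1 := passage_of_mem a hℓ (hij.le.trans hr)
  have e2 := passage_of_mem a (hℓ.trans hij.le) hr
  have e3 := passage_of_mem (transfer i a) (hℓ.trans hij.le) hr
  have e4 := passage_of_mem (transfer j a) hℓ (hij.le.trans hr)
  rw [transfer_of_mem a hℓ (hij.le.trans hr)] at e3
  rw [transfer_of_mem a (hℓ.trans hij.le) hr] at e4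
  have mαu := passage_pred_right_le i a (ℓ + 1) r
  have mαl := passage_succ_left_le i a ℓ (r - 1)
  have mγu := passage_pred_right_le j a (ℓ + 1) r
  have mγl := passage_succ_left_le j a ℓ (r - 1)
  have mβu := passage_pred_right_le j (transfer i a) (ℓ + 1) r
  have mβl := passage_succ_left_le j (transfer i a) ℓ (r - 1)
  have mδu := passage_pred_right_le i (transfer j a) (ℓ + 1) r
  have mδl := passage_succ_left_le i (transfer j a) ℓ (r - 1)
  rw [transfer_of_mem _ (hℓ.trans hij.le) hr, transfer_of_mem _ hℓ (hij.le.trans hr)]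
  -- Since min + max is the sum, α + β equals (αu + αl - αd) + (βu + βl - βd) + `a ℓ r` minus the
  -- doubly transferred entry min(βu, βl) - βd. The same holds for γ + δ, so the four corner
  -- identities force the two entries to agree. With the minima and maxima as atoms this is linear.
  have a1 := min_add_max (passage i a (ℓ + 1) r) (passage i a ℓ (r - 1))
  have a2 := min_add_max (passage j a (ℓ + 1) r) (passage j a ℓ (r - 1))
  have a3 := min_add_max (passage j (transfer i a) (ℓ + 1) r) (passage j (transfer i a) ℓ (r - 1))
  have a4 := min_add_max (passage i (transfer j a) (ℓ + 1) r) (passage i (transfer j a) ℓ (r - 1))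
  have b1 := le_min mαu mαl
  have b2 := le_min mγu mγl
  have b3 := le_min mβu mβl
  have b4 := le_min mδu mδl
  clear mαu mαl mγu mγl mβu mβl mδu mδl
  generalize min (passage i a (ℓ + 1) r) _ = n1 at *
  generalize min (passage j a (ℓ + 1) r) _ = n2 at *
  generalize min (passage j (transfer i a) (ℓ + 1) r) _ = n3 at *
  generalize min (passage i (transfer j a) (ℓ + 1) r) _ = n4 at *
  generalize max (passage i a (ℓ + 1) r) _ = m1 at *
  generalize max (passage j a (ℓ + 1) r) _ = m2 at *
  generalize max (passage j (transfer i a) (ℓ + 1) r) _ = m3 at *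
  generalize max (passage i (transfer j a) (ℓ + 1) r) _ = m4 at *
  omega

theorem transfer_comm (i j : ℤ) (a : ℤ → ℤ → ℕ) :
    transfer j (transfer i a) = transfer i (transfer j a) := by
  rcases lt_trichotomy i j with h | rfl | h
  · exact transfer_comm_of_lt h a
  · rfl
  · exact (transfer_comm_of_lt h a).symm
-- Multiplicities and box counts
variable {n : ℕ}

/-- The loop `L` lies between the columns `ℓ` and `r`. -/
def Loop.InBox (ℓ r : ℤ) (L : Loop n) : Prop := ℓ ≤ (L.left : ℕ) ∧ ((L.right : ℕ) : ℤ) ≤ r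

instance (ℓ r : ℤ) (L : Loop n) : Decidable (L.InBox ℓ r) :=
  inferInstanceAs (Decidable (_ ∧ _))

/-- The multiplicity in `p` of the loop with ends `ℓ` and `r`. -/
def mult (p : Picture n) (ℓ r : ℤ) : ℕ :=
  p.countP fun L => ((L.left : ℕ) : ℤ) = ℓ ∧ ((L.right : ℕ) : ℤ) = r

theorem count_eq_mult (p : Picture n) (L : Loop n) :
    p.count L = mult p (L.left : ℕ) (L.right : ℕ) := by
  refine Multiset.countP_congr rfl fun M _ => ?_
  simp only [Loop.ext_iff, Fin.ext_iff, Nat.cast_inj, eq_iff_iff]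
  tauto

theorem mult_injective : Function.Injective (mult (n := n)) := fun p q h => by
  ext L
  rw [count_eq_mult, count_eq_mult, h]

theorem exists_loop_of_mult_pos {p : Picture n} {ℓ r : ℤ} (h : 0 < mult p ℓ r) :
    ∃ L ∈ p, ((L.left : ℕ) : ℤ) = ℓ ∧ ((L.right : ℕ) : ℤ) = r :=
  Multiset.countP_pos.1 h

/-- Inclusion-exclusion: a loop in the box either has both ends on its boundary columns or lies in a
box shrunk on one side. -/
theorem mult_add_countP_inBox (p : Picture n) (ℓ r : ℤ) :
    mult p ℓ r + p.countP (Loop.InBox (ℓ + 1) r) + p.countP (Loop.InBox ℓ (r - 1)) =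
      p.countP (Loop.InBox ℓ r) + p.countP (Loop.InBox (ℓ + 1) (r - 1)) := by
  induction p using Multiset.induction with
  | empty => rfl
  | cons L p ih =>
    simp only [mult, Multiset.countP_cons] at ih ⊢
    split_ifs <;> simp only [Loop.InBox] at * <;> omega

/-- The level of a drawn loop in `q`, expressed through last passage times. -/
def height (q : Picture n) (i : ℤ) (x : Loop n × ℕ) : ℕ :=
  max (passage i (mult q) ((x.1.left : ℕ) + 1) (x.1.right : ℕ))
    (passage i (mult q) (x.1.left : ℕ) ((x.1.right : ℕ) - 1)) + x.2

/-! ### Levels of encirclement as passage times -/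

section Levels

variable {q : Picture n} {i : Fin n}

theorem height_lt_passage (hq : ∀ L ∈ q, L.PassesThrough i) {x : Loop n × ℕ}
    (hx : x ∈ q.toEnumFinset) {ℓ r : ℤ} (hb : x.1.InBox ℓ r) :
    height q (i : ℕ) x < passage (i : ℕ) (mult q) ℓ r := by
  obtain ⟨h1, h2⟩ := hq _ (Multiset.mem_of_mem_toEnumFinset hx)
  rw [Multiset.mem_toEnumFinset, count_eq_mult] at hx
  calc height q (i : ℕ) x
      < passage (i : ℕ) (mult q) (x.1.left : ℕ) (x.1.right : ℕ) := by
        rw [passage_of_mem _ (by exact_mod_cast h1) (by exact_mod_cast h2)]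
        exact Nat.add_lt_add_left hx _
    _ ≤ passage (i : ℕ) (mult q) ℓ (x.1.right : ℕ) := passage_antitone_left _ _ _ hb.1
    _ ≤ passage (i : ℕ) (mult q) ℓ r := passage_monotone_right _ _ _ hb.2

/-- Heights in a box leave no gaps: the two smaller boxes supply the values below their passage
times, and the copies of the outermost loop supply the rest. -/
theorem exists_height_eq (hq : ∀ L ∈ q, L.PassesThrough i) {ℓ r : ℤ} {k : ℕ}
    (hk : k < passage (i : ℕ) (mult q) ℓ r) :
    ∃ x ∈ q.toEnumFinset, x.1.InBox ℓ r ∧ height q (i : ℕ) x = k := by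
  by_cases h : ℓ ≤ (i : ℕ) ∧ ((i : ℕ) : ℤ) ≤ r
  · rw [passage_of_mem _ h.1 h.2] at hk
    rcases lt_or_ge k (passage (i : ℕ) (mult q) (ℓ + 1) r) with h1 | h1
    · obtain ⟨x, hx, hb, he⟩ := exists_height_eq hq h1
      exact ⟨x, hx, ⟨by have := hb.1; omega, hb.2⟩, he⟩
    rcases lt_or_ge k (passage (i : ℕ) (mult q) ℓ (r - 1)) with h2 | h2
    · obtain ⟨x, hx, hb, he⟩ := exists_height_eq hq h2
      exact ⟨x, hx, ⟨hb.1, by have := hb.2; omega⟩, he⟩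
    obtain ⟨L, -, rfl, rfl⟩ := exists_loop_of_mult_pos (p := q) (ℓ := ℓ) (r := r) (by omega)
    refine ⟨(L, k - max (passage (i : ℕ) (mult q) ((L.left : ℕ) + 1) (L.right : ℕ))
      (passage (i : ℕ) (mult q) (L.left : ℕ) ((L.right : ℕ) - 1))), ?_, ⟨le_rfl, le_rfl⟩, ?_⟩
    · rw [Multiset.mem_toEnumFinset, count_eq_mult]
      dsimp only
      omega
    · exact Nat.add_sub_of_le (max_le h1 h2)
  · rw [passage, if_neg h] at hk
    omega
termination_by (r - ℓ + 1).toNat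

theorem height_lt_of_encircled (hq : ∀ L ∈ q, L.PassesThrough i) {x y : Loop n × ℕ}
    (hy : y ∈ q.toEnumFinset) (h : Encircled y x) :
    height q (i : ℕ) y < height q (i : ℕ) x := by
  rcases h with ⟨hne, h1, h2⟩ | ⟨he, hlt⟩
  · rw [Ne, Loop.ext_iff, Fin.ext_iff, Fin.ext_iff] at hne
    rw [Fin.le_def] at h1 h2
    by_cases hl : (y.1.left : ℕ) = x.1.left
    · have := height_lt_passage hq hy (ℓ := (x.1.left : ℕ)) (r := (x.1.right : ℕ) - 1)
        ⟨by omega, by omega⟩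
      exact this.trans_le ((le_max_right _ _).trans (Nat.le_add_right _ _))
    · have := height_lt_passage hq hy (ℓ := (x.1.left : ℕ) + 1) (r := (x.1.right : ℕ))
        ⟨by omega, by omega⟩
      exact this.trans_le ((le_max_left _ _).trans (Nat.le_add_right _ _))
  · unfold height
    rw [he]
    omega

theorem exists_encircled (hq : ∀ L ∈ q, L.PassesThrough i) {x : Loop n × ℕ}
    (hx : x ∈ q.toEnumFinset) {m : ℕ} (hm : m < height q (i : ℕ) x) :
    ∃ y ∈ q.toEnumFinset, m ≤ height q (i : ℕ) y ∧ Encircled y x := by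
  rw [Multiset.mem_toEnumFinset] at hx
  rcases Nat.eq_zero_or_pos x.2 with h0 | h0
  · rw [height, h0, Nat.add_zero, lt_max_iff] at hm
    rcases hm with hm | hm
    · obtain ⟨y, hy, ⟨h1, h2⟩, rfl⟩ := exists_height_eq hq hm
      refine ⟨y, hy, le_rfl, Or.inl ⟨fun e => ?_, Fin.le_def.2 (by omega), Fin.le_def.2 (by omega)⟩⟩
      rw [e] at h1
      omega
    · obtain ⟨y, hy, ⟨h1, h2⟩, rfl⟩ := exists_height_eq hq hm
      refine ⟨y, hy, le_rfl, Or.inl ⟨fun e => ?_, Fin.le_def.2 (by omega), Fin.le_def.2 (by omega)⟩⟩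
      rw [e] at h2
      omega
  · refine ⟨(x.1, x.2 - 1), ?_, ?_, Or.inr ⟨rfl, by dsimp only; omega⟩⟩
    · rw [Multiset.mem_toEnumFinset]
      dsimp only
      omega
    · unfold height at hm ⊢
      dsimp only
      omega

theorem mem_remaining_iff (hq : ∀ L ∈ q, L.PassesThrough i) (m : ℕ) (x : Loop n × ℕ) :
    x ∈ remaining q m ↔ x ∈ q.toEnumFinset ∧ m ≤ height q (i : ℕ) x := by
  induction m generalizing x with
  | zero => simp [remaining]
  | succ m ih =>
    simp only [remaining, innermost, Finset.mem_sdiff, Finset.mem_filter, ih]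
    constructor
    · rintro ⟨⟨hx, hm⟩, h⟩
      push Not at h
      obtain ⟨y, ⟨hy, hmy⟩, he⟩ := h ⟨hx, hm⟩
      exact ⟨hx, hmy.trans_lt (height_lt_of_encircled hq hy he)⟩
    · rintro ⟨hx, hm⟩
      refine ⟨⟨hx, by omega⟩, fun h => ?_⟩
      obtain ⟨y, hy, hmy, he⟩ := exists_encircled hq hx hm
      exact h.2 y ⟨hy, hmy⟩ he

theorem mem_level_iff (hq : ∀ L ∈ q, L.PassesThrough i) (m : ℕ) (x : Loop n × ℕ) :
    x ∈ level q m ↔ x ∈ q.toEnumFinset ∧ height q (i : ℕ) x = m := by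
  have h1 := mem_remaining_iff hq m x
  have h2 := mem_remaining_iff hq (m + 1) x
  have h3 : x ∈ remaining q (m + 1) ↔ x ∈ remaining q m ∧ x ∉ level q m := Finset.mem_sdiff
  have h4 : x ∈ level q m → x ∈ remaining q m := Finset.mem_of_mem_filter x
  constructor
  · intro h
    have := h1.1 (h4 h)
    refine ⟨this.1, ?_⟩
    by_contra hne
    exact (h3.1 (h2.2 ⟨this.1, by omega⟩)).2 h
  · rintro ⟨hx, rfl⟩
    by_contra h
    have := (h2.1 (h3.2 ⟨h1.2 ⟨hx, le_rfl⟩, h⟩)).2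
    omega

theorem passage_le_card (hq : ∀ L ∈ q, L.PassesThrough i) (ℓ r : ℤ) :
    passage (i : ℕ) (mult q) ℓ r ≤ q.card := by
  rw [← Multiset.card_toEnumFinset, ← Finset.card_range (passage _ _ _ _)]
  refine (Finset.card_le_card fun k hk => ?_).trans
    (Finset.card_image_le (s := q.toEnumFinset) (f := height q (i : ℕ)))
  obtain ⟨x, hx, -, he⟩ := exists_height_eq hq (Finset.mem_range.1 hk)
  exact Finset.mem_image.2 ⟨x, hx, he⟩

theorem sum_nonempty_levels (hq : ∀ L ∈ q, L.PassesThrough i) (ℓ r : ℤ) :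
    ∑ k ∈ Finset.range q.card,
        (if ((level q k).filter fun x => x.1.InBox ℓ r).Nonempty then 1 else 0) =
      passage (i : ℕ) (mult q) ℓ r := by
  rw [← Finset.card_filter, ← Finset.card_range (passage _ _ _ _)]
  congr 1
  ext k
  rw [Finset.mem_filter, Finset.mem_range, Finset.mem_range]
  constructor
  · rintro ⟨-, x, hx⟩
    obtain ⟨hx, hb⟩ := Finset.mem_filter.1 hx
    obtain ⟨hxq, rfl⟩ := (mem_level_iff hq k x).1 hx
    exact height_lt_passage hq hxq hb
  · intro hk
    obtain ⟨x, hx, hb, he⟩ := exists_height_eq hq hk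
    exact ⟨hk.trans_le (passage_le_card hq ℓ r), x,
      Finset.mem_filter.2 ⟨(mem_level_iff hq k x).2 ⟨hx, he⟩, hb⟩⟩

theorem countP_eq_card_filter_toEnumFinset (q : Picture n) (P : Loop n → Prop) [DecidablePred P] :
    q.countP P = (q.toEnumFinset.filter fun x => P x.1).card := by
  conv_lhs => rw [← Multiset.map_toEnumFinset_fst q, Multiset.countP_map]
  rfl

theorem sum_card_levels (hq : ∀ L ∈ q, L.PassesThrough i) (ℓ r : ℤ) :
    ∑ k ∈ Finset.range q.card, ((level q k).filter fun x => x.1.InBox ℓ r).card =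
      q.countP (Loop.InBox ℓ r) := by
  rw [countP_eq_card_filter_toEnumFinset,
    Finset.card_eq_sum_card_fiberwise (f := height q (i : ℕ)) (t := Finset.range q.card)]
  · refine Finset.sum_congr rfl fun k _ => congrArg _ ?_
    ext x
    simp only [Finset.mem_filter, mem_level_iff hq]
    tauto
  · intro x hx
    have hx' := Finset.mem_filter.1 (Finset.mem_coe.1 hx)
    exact Finset.mem_coe.2 (Finset.mem_range.2
      ((height_lt_passage hq hx'.1 hx'.2).trans_le (passage_le_card hq ℓ r)))

end Levels

/-! ### Counting the new loops -/

theorem leftOf_or_leftOf {q : Picture n} {k : ℕ} {x y : Loop n × ℕ} (hx : x ∈ level q k)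
    (hy : y ∈ level q k) (hne : x ≠ y) : x.1.LeftOf y.1 ∨ y.1.LeftOf x.1 := by
  have h1 := (Finset.mem_filter.1 hx).2 y (Finset.mem_of_mem_filter y hy)
  have h2 := (Finset.mem_filter.1 hy).2 x (Finset.mem_of_mem_filter x hx)
  by_cases he : x.1 = y.1
  · have : x.2 ≠ y.2 := fun h => hne (Prod.ext he h)
    rcases this.lt_or_gt with h | h
    · exact absurd (Or.inr ⟨he, h⟩) h2
    · exact absurd (Or.inr ⟨he.symm, h⟩) h1
  · have h1' : ¬ y.1.Within x.1 := fun h => h1 (Or.inl ⟨fun e => he e.symm, h⟩)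
    have h2' : ¬ x.1.Within y.1 := fun h => h2 (Or.inl ⟨he, h⟩)
    simp only [Loop.Within, Loop.LeftOf] at *
    omega

/-- A join lies in the box exactly when both of its loops do, so the joins in the box correspond to
the loops there other than the leftmost one. -/
theorem card_neighbours_inBox {S : Finset (Loop n × ℕ)}
    (hS : ∀ x ∈ S, ∀ y ∈ S, x ≠ y → x.1.LeftOf y.1 ∨ y.1.LeftOf x.1) (ℓ r : ℤ) :
    ((neighbours S).filter fun c => (c.1.1.join c.2.1).InBox ℓ r).card +
        (if (S.filter fun x => x.1.InBox ℓ r).Nonempty then 1 else 0) =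
      (S.filter fun x => x.1.InBox ℓ r).card := by
  set T := S.filter fun x => x.1.InBox ℓ r with hT
  have mT : ∀ {x}, x ∈ T ↔ x ∈ S ∧ x.1.InBox ℓ r := Finset.mem_filter
  have mN : ∀ {c}, c ∈ (neighbours S).filter (fun c => (c.1.1.join c.2.1).InBox ℓ r) ↔
      c.1 ∈ T ∧ c.2 ∈ T ∧ c.1.1.LeftOf c.2.1 ∧
        ∀ z ∈ S, ¬ (c.1.1.LeftOf z.1 ∧ z.1.LeftOf c.2.1) := by
    intro c
    simp only [neighbours, Finset.mem_filter, Finset.mem_product, mT]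
    constructor
    · rintro ⟨⟨⟨h1, h2⟩, h3, h4⟩, h5⟩
      rw [Loop.InBox, Loop.join_left h3, Loop.join_right h3] at h5
      have := h3.1
      have := h3.2
      exact ⟨⟨h1, h5.1, by omega⟩, ⟨h2, by omega, h5.2⟩, h3, h4⟩
    · rintro ⟨⟨h1, h5⟩, ⟨h2, h6⟩, h3, h4⟩
      refine ⟨⟨⟨h1, h2⟩, h3, h4⟩, ?_⟩
      rw [Loop.InBox, Loop.join_left h3, Loop.join_right h3]
      exact ⟨h5.1, h6.2⟩
  rw [← Finset.card_filter_add_card_filter_not (s := T) fun y => ∃ x ∈ T, x.1.LeftOf y.1]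
  congr 1
  · refine Finset.card_bij (fun c _ => c.2) ?_ ?_ ?_
    · intro c hc
      obtain ⟨h1, h2, h3, -⟩ := mN.1 hc
      exact Finset.mem_filter.2 ⟨h2, c.1, h1, h3⟩
    · intro c hc d hd he
      obtain ⟨h1, -, h3, h4⟩ := mN.1 hc
      obtain ⟨g1, -, g3, g4⟩ := mN.1 hd
      refine Prod.ext ?_ he
      by_contra hne
      rcases hS _ (mT.1 h1).1 _ (mT.1 g1).1 hne with h | h
      · exact h4 _ (mT.1 g1).1 ⟨h, by rw [he]; exact g3⟩
      · exact g4 _ (mT.1 h1).1 ⟨h, by rw [← he]; exact h3⟩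
    · intro y hy
      obtain ⟨hyT, x, hx, hxy⟩ := Finset.mem_filter.1 hy
      obtain ⟨m, hm, hmax⟩ := (T.filter fun x => x.1.LeftOf y.1).exists_max_image
        (fun x => x.1.left) ⟨x, Finset.mem_filter.2 ⟨hx, hxy⟩⟩
      obtain ⟨hmT, hmy⟩ := Finset.mem_filter.1 hm
      refine ⟨(m, y), mN.2 ⟨hmT, hyT, hmy, ?_⟩, rfl⟩
      rintro z hz ⟨hmz, hzy⟩
      -- The loops in the box are consecutive in `S`, so a neighbour within the box is a neighbour
      -- in `S`.
      have hzT : z ∈ T := by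
        refine mT.2 ⟨hz, ?_⟩
        have h1 := (mT.1 hmT).2.1
        have h2 := (mT.1 hyT).2.2
        have h3 := hmz.1
        have h4 := hzy.2
        dsimp only at h3 h4
        exact ⟨by omega, by omega⟩
      exact (hmax z (Finset.mem_filter.2 ⟨hzT, hzy⟩)).not_gt hmz.1
  · split_ifs with hne
    · obtain ⟨m, hm, hmin⟩ := T.exists_min_image (fun x => x.1.left) hne
      symm
      rw [Finset.card_eq_one]
      refine ⟨m, ?_⟩
      ext y
      simp only [Finset.mem_filter, Finset.mem_singleton, not_exists, not_and]
      constructor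
      · rintro ⟨hy, h⟩
        by_contra hne
        rcases hS _ (mT.1 hy).1 _ (mT.1 hm).1 hne with h' | h'
        · exact (hmin y hy).not_gt h'.1
        · exact h m hm h'
      · rintro rfl
        exact ⟨hm, fun x hx h => (hmin x hx).not_gt h.1⟩
    · rw [Finset.not_nonempty_iff_eq_empty.1 hne]
      rfl

theorem countP_newLoops_add_passage {q : Picture n} {i : Fin n}
    (hq : ∀ L ∈ q, L.PassesThrough i) (ℓ r : ℤ) :
    (newLoops q).countP (Loop.InBox ℓ r) + passage (i : ℕ) (mult q) ℓ r =
      q.countP (Loop.InBox ℓ r) := by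
  rw [← sum_card_levels hq, ← sum_nonempty_levels hq, newLoops,
    ← Multiset.coe_countPAddMonoidHom, map_sum, ← Finset.sum_add_distrib]
  refine Finset.sum_congr rfl fun k _ => ?_
  rw [← card_neighbours_inBox (S := level q k) fun x hx y hy h => leftOf_or_leftOf hx hy h,
    Multiset.coe_countPAddMonoidHom, joins, Multiset.countP_map]
  rfl

theorem mult_replaced (p : Picture n) (i : Fin n) :
    mult (replaced p i) = transfer (i : ℕ) (mult p) := by
  have hq : ∀ L ∈ through p i, L.PassesThrough i := fun L hL => (Multiset.mem_filter.1 hL).2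
  have hmq : ∀ ℓ r : ℤ, ℓ ≤ (i : ℕ) → ((i : ℕ) : ℤ) ≤ r → mult (through p i) ℓ r = mult p ℓ r := by
    intro ℓ r h1 h2
    rw [mult, through, Multiset.countP_filter, mult]
    refine Multiset.countP_congr rfl fun L _ => ?_
    simp only [Loop.PassesThrough, Fin.le_def, eq_iff_iff]
    omega
  have hpass : ∀ ℓ r, passage (i : ℕ) (mult (through p i)) ℓ r = passage (i : ℕ) (mult p) ℓ r :=
    fun ℓ r => passage_congr fun ℓ' r' _ h1 h2 _ => hmq ℓ' r' h1 h2
  funext ℓ r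
  rw [replaced, mult, Multiset.countP_add, ← mult, ← mult]
  have hC := fun ℓ r => countP_newLoops_add_passage hq ℓ r
  -- Take mixed second differences of the box identity `hC`; `m1` and `m2` ensure that the
  -- subtraction in `transfer` is not truncated.
  have e1 := mult_add_countP_inBox (newLoops (through p i)) ℓ r
  have e2 := mult_add_countP_inBox (through p i) ℓ r
  have c1 := hC ℓ r
  have c2 := hC (ℓ + 1) r
  have c3 := hC ℓ (r - 1)
  have c4 := hC (ℓ + 1) (r - 1)
  have hsplit : mult (p.filter fun L => ¬ L.PassesThrough i) ℓ r + mult (through p i) ℓ r =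
      mult p ℓ r := by
    rw [mult, mult, ← Multiset.countP_add, add_comm, through, Multiset.filter_add_not, mult]
  have m1 := passage_pred_right_le (i : ℕ) (mult (through p i)) (ℓ + 1) r
  have m2 := passage_succ_left_le (i : ℕ) (mult (through p i)) ℓ (r - 1)
  by_cases h : ℓ ≤ (i : ℕ) ∧ ((i : ℕ) : ℤ) ≤ r
  · have h5 := passage_of_mem (mult (through p i)) h.1 h.2
    rw [transfer_of_mem _ h.1 h.2, ← hpass, ← hpass, ← hpass]
    have := hmq ℓ r h.1 h.2
    omega
  · have h5 : ∀ ℓ' r', ℓ ≤ ℓ' → r' ≤ r → passage (i : ℕ) (mult (through p i)) ℓ' r' = 0 :=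
      fun ℓ' r' h1 h2 => by rw [passage, if_neg (by omega)]
    have := h5 ℓ r le_rfl le_rfl
    have := h5 (ℓ + 1) r (by omega) le_rfl
    have := h5 ℓ (r - 1) le_rfl (by omega)
    have := h5 (ℓ + 1) (r - 1) (by omega) (by omega)
    rw [transfer, if_neg h]
    omega

theorem replaced_comm (p : Picture n) (i j : Fin n) :
    replaced (replaced p i) j = replaced (replaced p j) i :=
  mult_injective (by rw [mult_replaced, mult_replaced, mult_replaced, mult_replaced, transfer_comm])

/-! ### Renumbering and crossing out columns -/

section Renumbering
variable {m n : ℕ}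

/-- The loop obtained from `L` by renumbering the columns along an order embedding. -/
def Loop.map (e : Fin m ↪o Fin n) (L : Loop m) : Loop n where
  left := e L.left
  right := e L.right
  lt := e.lt_iff_lt.2 L.lt

theorem Loop.map_injective (e : Fin m ↪o Fin n) : Function.Injective (Loop.map e) := by
  intro L L' h
  exact Loop.ext (e.injective (congrArg Loop.left h)) (e.injective (congrArg Loop.right h))

/-- The renumbering of drawn loops. -/
def drawnMap (e : Fin m ↪o Fin n) : Loop m × ℕ ↪ Loop n × ℕ :=
  ⟨Prod.map (Loop.map e) id, (Loop.map_injective e).prodMap Function.injective_id⟩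

theorem Loop.passesThrough_map (e : Fin m ↪o Fin n) (L : Loop m) (i : Fin m) :
    (L.map e).PassesThrough (e i) ↔ L.PassesThrough i :=
  and_congr e.le_iff_le e.le_iff_le

theorem Loop.leftOf_map (e : Fin m ↪o Fin n) (L L' : Loop m) :
    (L.map e).LeftOf (L'.map e) ↔ L.LeftOf L' :=
  and_congr e.lt_iff_lt e.lt_iff_lt

theorem Loop.join_map (e : Fin m ↪o Fin n) (L L' : Loop m) :
    (L.map e).join (L'.map e) = (L.join L').map e :=
  Loop.ext (e.monotone.map_min).symm (e.monotone.map_max).symm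

theorem encircled_drawnMap (e : Fin m ↪o Fin n) (x y : Loop m × ℕ) :
    Encircled (drawnMap e x) (drawnMap e y) ↔ Encircled x y :=
  or_congr (and_congr (Loop.map_injective e).ne_iff (and_congr e.le_iff_le e.le_iff_le))
    (and_congr (Loop.map_injective e).eq_iff Iff.rfl)

theorem toEnumFinset_map (e : Fin m ↪o Fin n) (q : Picture m) :
    Multiset.toEnumFinset (q.map (Loop.map e)) = q.toEnumFinset.map (drawnMap e) := by
  ext ⟨L, k⟩
  rw [Multiset.mem_toEnumFinset, Finset.mem_map]
  constructor
  · intro h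
    obtain ⟨L', -, rfl⟩ := Multiset.mem_map.1 (Multiset.count_pos.1 (Nat.zero_lt_of_lt h))
    rw [Multiset.count_map_eq_count' _ _ (Loop.map_injective e)] at h
    exact ⟨(L', k), (Multiset.mem_toEnumFinset _ _).2 h, rfl⟩
  · rintro ⟨⟨L', k'⟩, h, he⟩
    obtain ⟨rfl, rfl⟩ := Prod.mk.inj he
    rw [Multiset.count_map_eq_count' _ _ (Loop.map_injective e)]
    exact (Multiset.mem_toEnumFinset _ _).1 h

theorem innermost_map (e : Fin m ↪o Fin n) (S : Finset (Loop m × ℕ)) :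
    innermost (S.map (drawnMap e)) = (innermost S).map (drawnMap e) := by
  rw [innermost, Finset.filter_map, innermost]
  congr 1
  refine Finset.filter_congr fun x _ => ?_
  simp only [Function.comp, Finset.forall_mem_map, encircled_drawnMap]

theorem remaining_map (e : Fin m ↪o Fin n) (q : Picture m) (k : ℕ) :
    remaining (q.map (Loop.map e)) k = (remaining q k).map (drawnMap e) := by
  induction k with
  | zero => exact toEnumFinset_map e q
  | succ k ih => rw [remaining, ih, innermost_map, ← Finset.map_sdiff, remaining]

theorem neighbours_map (e : Fin m ↪o Fin n) (S : Finset (Loop m × ℕ)) :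
    neighbours (S.map (drawnMap e)) =
      (neighbours S).map ((drawnMap e).prodMap (drawnMap e)) := by
  rw [neighbours, ← Finset.prodMap_map_product, Finset.filter_map, neighbours]
  congr 1
  refine Finset.filter_congr fun c _ => ?_
  simp only [Function.comp, Finset.forall_mem_map]
  exact and_congr (Loop.leftOf_map e _ _) (forall₂_congr fun z _ =>
    not_congr (and_congr (Loop.leftOf_map e _ _) (Loop.leftOf_map e _ _)))

theorem joins_map (e : Fin m ↪o Fin n) (S : Finset (Loop m × ℕ)) :
    joins (S.map (drawnMap e)) = (joins S).map (Loop.map e) := by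
  rw [joins, neighbours_map, Finset.map_val, Multiset.map_map, joins, Multiset.map_map]
  exact Multiset.map_congr rfl fun c _ => Loop.join_map e _ _

theorem newLoops_map (e : Fin m ↪o Fin n) (q : Picture m) :
    newLoops (q.map (Loop.map e)) = (newLoops q).map (Loop.map e) := by
  rw [newLoops, newLoops, Multiset.card_map, ← Multiset.coe_mapAddMonoidHom, map_sum]
  refine Finset.sum_congr rfl fun k _ => ?_
  rw [Multiset.coe_mapAddMonoidHom, level, remaining_map, innermost_map, joins_map, level]

theorem replaced_map (e : Fin m ↪o Fin n) (p : Picture m) (i : Fin m) :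
    replaced (p.map (Loop.map e)) (e i) = (replaced p i).map (Loop.map e) := by
  rw [replaced, replaced, Multiset.map_add, ← newLoops_map, through, through,
    Multiset.filter_map, Multiset.filter_map]
  simp only [Function.comp_def, Loop.passesThrough_map]

end Renumbering

theorem succAbove_renumber (i j : Fin (n + 1)) (h : j ≠ i) :
    i.succAboveOrderEmb (renumber i j h) = j :=
  congrArg Subtype.val ((finSuccAboveOrderIso i).apply_symm_apply ⟨j, h⟩)

/-- Putting column `i` back into the collapse gives the picture before it was crossed out. -/
theorem map_collapse (p : Picture (n + 1)) (i : Fin (n + 1)) :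
    (collapse p i).map (Loop.map i.succAboveOrderEmb) = replaced p i := by
  rw [collapse, Multiset.map_pmap]
  conv_rhs => rw [← Multiset.map_id (replaced p i), ← Multiset.pmap_eq_map _ _ _
    fun _ hL => ends_ne_of_mem_replaced hL]
  exact Multiset.pmap_congr _ fun L _ h _ =>
    Loop.ext (succAbove_renumber i _ h.1) (succAbove_renumber i _ h.2)

/-- The order embedding that leaves out the columns `i₁` and `i₂`. -/
def skipTwo (i₁ i₂ : Fin (n + 2)) (h : i₁ ≠ i₂) : Fin n ↪o Fin (n + 2) :=
  (renumber i₁ i₂ h.symm).succAboveOrderEmb.trans i₁.succAboveOrderEmb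

theorem range_skipTwo (i₁ i₂ : Fin (n + 2)) (h : i₁ ≠ i₂) :
    Set.range (skipTwo i₁ i₂ h) = {i₁, i₂}ᶜ := by
  ext j
  simp only [Set.mem_compl_iff, Set.mem_insert_iff, Set.mem_singleton_iff, not_or]
  constructor
  · rintro ⟨k, rfl⟩
    refine ⟨Fin.succAbove_ne _ _, fun e => ?_⟩
    exact Fin.succAbove_ne _ _
      (i₁.succAboveOrderEmb.injective (e.trans (succAbove_renumber i₁ i₂ h.symm).symm))
  · rintro ⟨h1, h2⟩
    have h3 : renumber i₁ j h1 ≠ renumber i₁ i₂ h.symm := fun e => h2 (by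
      rw [← succAbove_renumber i₁ j h1, e, succAbove_renumber])
    obtain ⟨k, hk⟩ := Fin.exists_succAbove_eq h3
    exact ⟨k, (congrArg i₁.succAbove hk).trans (succAbove_renumber i₁ j h1)⟩

/-- An order embedding of `Fin n` is determined by its range, here the complement of an unordered
pair. -/
theorem skipTwo_comm (i₁ i₂ : Fin (n + 2)) (h : i₁ ≠ i₂) :
    skipTwo i₁ i₂ h = skipTwo i₂ i₁ h.symm :=
  OrderEmbedding.range_inj.1 (by rw [range_skipTwo, range_skipTwo, Set.pair_comm])

theorem map_collapsePair (p : Picture (n + 2)) (i₁ i₂ : Fin (n + 2)) (h : i₁ ≠ i₂) :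
    (collapsePair p i₁ i₂ h).map (Loop.map (skipTwo i₁ i₂ h)) =
      replaced (replaced p i₁) i₂ := by
  rw [← map_collapse p i₁]
  conv_rhs => rw [← succAbove_renumber i₁ i₂ h.symm]
  rw [replaced_map, ← map_collapse, Multiset.map_map]
  rfl

end Kostant

theorem mainTheorem5 (n : ℕ) (p : Kostant.Picture (n + 2)) (i₁ i₂ : Fin (n + 2)) (h : i₁ ≠ i₂) :
    Kostant.collapsePair p i₁ i₂ h = Kostant.collapsePair p i₂ i₁ h.symm := by
  apply Multiset.map_injective (Kostant.Loop.map_injective (Kostant.skipTwo i₁ i₂ h))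
  rw [Kostant.map_collapsePair, Kostant.replaced_comm, Kostant.skipTwo_comm,
    Kostant.map_collapsePair]
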